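/- Let $m,n\ge 0$ be integers and let $H_1,\dots,H_m\in\mathbb R^{n\times n}$. For delays $\tau=(\tau_1,\dots,\tau_m)$ with all $\tau_k>0$ put $r=\max_k\tau_k$ ($r=0$ if $m=0$) and consider the difference equation $$x(t)+\sum_{k=1}^m H_k\,x(t-\tau_k)=0,\qquad t\ge 0, \tag{1}$$ whose solutions are the continuous functions $x:[-r,\infty)\to\mathbb R^n$ that satisfy it for all $t\ge0$. Equation (1) is exponentially stable for the delays $\tau$ if there are $M\in\mathbb R$ and $\alpha>0$ such that every solution satisfies $\|x(t)\|\le M e^{-\alpha t}\sup_{s\in[-r,0]}\|x(s)\|$ for all $t\ge0$. It is strongly stable if it is exponentially stable independently of the values of the delays, that is, for all $\tau\in(0,\infty)^m$. It is locally strongly stable at $\tau$ if there is $\delta>0$ such that it is exponentially stable for all delays $\tau'\in(0,\infty)^m$ with $|\tau'_k-\tau_k|<\delta$ for every $k$. For a polynomial $p(z_0)=p_0+p_1z_0+\cdots+p_nz_0^n$ with complex coefficients, let $S_1(p)$ and $S_2(p)$ be the upper triangular $n\times n$ Toeplitz matrices with first rows $(p_n,p_{n-1},\dots,p_1)$ and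 $(p_0,p_1,\dots,p_{n-1})$ respectively, and let $$\mathcal H(p)=S_1(p)^T\,\overline{S_1(p)}-\overline{S_2(p)}^{\,T}S_2(p)$$ be its discrete-time Hermite (Schur–Cohn) matrix, which is Hermitian and equals $S_1^TS_1-S_2^TS_2$ when the coefficients are real. For $z=(z_1,\dots,z_m)\in\mathbb C^m$ let $H(z_1,\dots,z_m)$ denote the Hermite matrix $\mathcal H(p)$ of the univariate polynomial $$p:\ z_0\mapsto\det\Big(z_0I_n+\sum_{k=1}^m z_kH_k\Big).$$ Then (1) is strongly stable if and only if $H(z_1,\dots,z_m)$ is positive definite for all $(z_1,\dots,z_m)\in\mathbb C^m$ with $|z_1|=\cdots=|z_m|=1$. Likewise, for every $\tau\in(0,\infty)^m$, equation (1) is locally strongly stable at $\tau$ if and only if $H(z_1,\dots,z_m)$ is positive definite for all such $(z_1,\dots,z_m)$. -/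

import Mathlib

open scoped Matrix ComplexOrder

namespace DelayDifference

noncomputable section

/-- The largest delay (it is `0` if there are no delays). -/
def maxDelay {m : ℕ} (τ : Fin m → ℝ) : ℝ := ⨆ k, τ k

/-- `x` is a continuous solution on `[-maxDelay τ, ∞)` of
`x(t) + ∑ k, H k x(t - τ k) = 0`, the equation being imposed for all `t ≥ 0`.
Values of `x` to the left of `-maxDelay τ` play no role. -/
structure IsSolution {m n : ℕ} (H : Fin m → Matrix (Fin n) (Fin n) ℝ) (τ : Fin m → ℝ)
    (x : ℝ → Fin n → ℝ) : Prop where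
  continuousOn : ContinuousOn x (Set.Ici (-maxDelay τ))
  equation : ∀ t : ℝ, 0 ≤ t → x t + ∑ k, H k *ᵥ x (t - τ k) = 0

/-- Exponential stability for the given delays: there are `M` and `α > 0` such that every
continuous solution satisfies `‖x(t)‖ ≤ M e^{-α t} sup_{[-maxDelay τ, 0]} ‖x‖` for `t ≥ 0`.
(All norms on `Fin n → ℝ` being equivalent, the choice of norm only affects `M`.) -/
def ExponentiallyStable {m n : ℕ} (H : Fin m → Matrix (Fin n) (Fin n) ℝ)
    (τ : Fin m → ℝ) : Prop :=
  ∃ M α : ℝ, 0 < α ∧ ∀ x : ℝ → Fin n → ℝ, IsSolution H τ x →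
    ∀ B : ℝ, (∀ s ∈ Set.Icc (-maxDelay τ) 0, ‖x s‖ ≤ B) →
      ∀ t : ℝ, 0 ≤ t → ‖x t‖ ≤ M * Real.exp (-α * t) * B

/-- Strong stability: exponential stability independently of the values of the delays. -/
def StronglyStable {m n : ℕ} (H : Fin m → Matrix (Fin n) (Fin n) ℝ) : Prop :=
  ∀ τ : Fin m → ℝ, (∀ k, 0 < τ k) → ExponentiallyStable H τ

/-- Strong stability in the local sense: exponential stability for all delays in a
neighbourhood of the nominal delays `τ`. -/
def LocallyStronglyStable {m n : ℕ} (H : Fin m → Matrix (Fin n) (Fin n) ℝ)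
    (τ : Fin m → ℝ) : Prop :=
  ∃ δ : ℝ, 0 < δ ∧ ∀ τ' : Fin m → ℝ, (∀ k, 0 < τ' k) → (∀ k, |τ' k - τ k| < δ) →
    ExponentiallyStable H τ'

/-- The univariate polynomial `z₀ ↦ det (z₀ I + ∑ k, z k H k)`. -/
def charPolynomial {m n : ℕ} (H : Fin m → Matrix (Fin n) (Fin n) ℝ) (z : Fin m → ℂ) :
    Polynomial ℂ :=
  Matrix.det ((Polynomial.X : Polynomial ℂ) • (1 : Matrix (Fin n) (Fin n) (Polynomial ℂ)) +
    (∑ k, z k • (H k).map (fun a : ℝ => (a : ℂ))).map Polynomial.C)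

/-- Upper triangular Toeplitz matrix with first row `p_n, p_{n-1}, …, p_1`. -/
def toeplitzTop (n : ℕ) (p : Polynomial ℂ) : Matrix (Fin n) (Fin n) ℂ :=
  Matrix.of fun i j => if i ≤ j then p.coeff (n - ((j : ℕ) - (i : ℕ))) else 0

/-- Upper triangular Toeplitz matrix with first row `p_0, p_1, …, p_{n-1}`. -/
def toeplitzBot (n : ℕ) (p : Polynomial ℂ) : Matrix (Fin n) (Fin n) ℂ :=
  Matrix.of fun i j => if i ≤ j then p.coeff ((j : ℕ) - (i : ℕ)) else 0

/-- The discrete-time Hermite (Schur–Cohn) matrix of `p = p_0 + p_1 X + ⋯ + p_n X^n`,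
for complex coefficients: `S₁ᵀ S̄₁ - S̄₂ᵀ S₂`. For real coefficients this is
`S₁ᵀ S₁ - S₂ᵀ S₂`. -/
def hermiteMatrix (n : ℕ) (p : Polynomial ℂ) : Matrix (Fin n) (Fin n) ℂ :=
  (toeplitzTop n p)ᵀ * (toeplitzTop n p).map star - (toeplitzBot n p)ᴴ * toeplitzBot n p

/-- The Hermite matrix `H(z_1, …, z_m)` of `z₀ ↦ det (z₀ I + ∑ k, z k H k)`. -/
def hermiteForm {m n : ℕ} (H : Fin m → Matrix (Fin n) (Fin n) ℝ) (z : Fin m → ℂ) :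
    Matrix (Fin n) (Fin n) ℂ :=
  hermiteMatrix n (charPolynomial H z)

end

end DelayDifference

/-! By the Schur–Cohn criterion (`hermiteMatrix_posDef_iff`), positivity of the Hermite matrix on
the torus says that `-symbolMatrix H z` has all its eigenvalues in the open unit disc for every `z`
there.

Sufficiency: in the Banach algebra of continuous matrix functions on the torus this gives spectral
radius below one, hence uniform geometric decay of powers. Cauchy's estimate passes the decay to the
Fourier coefficients, and an `N`-th power has only polynomially many of them, so their norms sum to
a geometric bound (`exists_sum_norm_coeff_delayPoly_pow_le`). Replacing the torus variables by delay
operators turns the same polynomial powers into the Neumann series of the difference equation. At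
time `t` only the terms of order at least about `t` divided by the largest delay contribute, whence
exponential decay.

Necessity: a high frequency lets delays arbitrarily close to `τ` realise any prescribed phases `z`.
Stability at those delays and Hurwitz's theorem exclude zeros of the determinant with weights `z k *
exp (-a * τ k)`, `a ≥ 0`. If an eigenvalue of modulus at least one existed at `a = 0`, take the
largest `a` at which one exists for some `z`. Modulus one is impossible because the phase can be
absorbed into `z`; modulus above one would persist for slightly larger `a`. -/

namespace DelayDifference

/-! ### The Schur–Cohn criterion through an energy identity for shifted sequences. -/

section SchurCohn

open Polynomial ComplexConjugate

/-- The backward shift `(S v) i = v (i + 1)` on complex sequences. -/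
def seqShift : Module.End ℂ (ℕ → ℂ) := LinearMap.funLeft ℂ ℂ Nat.succ

lemma seqShift_pow_apply (k : ℕ) (v : ℕ → ℂ) (i : ℕ) : (seqShift ^ k) v i = v (i + k) := by
  induction k generalizing v i with
  | zero => simp
  | succ k ih =>
    rw [pow_succ, Module.End.mul_apply, ih]
    simp [seqShift, LinearMap.funLeft_apply, add_assoc]

lemma aeval_seqShift_apply (f : ℂ[X]) (v : ℕ → ℂ) (i : ℕ) {d : ℕ} (hd : f.natDegree < d) :
    aeval seqShift f v i = ∑ j ∈ Finset.range d, f.coeff j * v (i + j) := by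
  rw [aeval_eq_sum_range' hd]
  simp [LinearMap.sum_apply, Finset.sum_apply, seqShift_pow_apply]

lemma aeval_seqShift_eq_zero_of_le (f : ℂ[X]) {v : ℕ → ℂ} {n : ℕ} (hv : ∀ i, n ≤ i → v i = 0) :
    ∀ i, n ≤ i → aeval seqShift f v i = 0 := by
  intro i hi
  rw [aeval_seqShift_apply f v i (Nat.lt_succ_self _)]
  exact Finset.sum_eq_zero fun j _ => by rw [hv _ (by omega), mul_zero]

lemma aeval_seqShift_eq_zero_of_lt (f : ℂ[X]) {v : ℕ → ℂ} {k : ℕ} (hv : ∀ i, i < k → v i = 0)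
    (j : ℕ) (hj : j + f.natDegree < k) : aeval seqShift f v j = 0 := by
  rw [aeval_seqShift_apply f v j (Nat.lt_succ_self _)]
  refine Finset.sum_eq_zero fun l hl => ?_
  rw [hv _ (by have := Finset.mem_range.1 hl; omega), mul_zero]

lemma aeval_seqShift_mul (f g : ℂ[X]) (v : ℕ → ℂ) :
    aeval seqShift (f * g) v = aeval seqShift f (aeval seqShift g v) := by
  rw [map_mul, Module.End.mul_apply]

lemma aeval_seqShift_X_sub_C (a : ℂ) (v : ℕ → ℂ) (i : ℕ) :
    aeval seqShift (X - C a) v i = v (i + 1) - a * v i := by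
  simp [seqShift, LinearMap.funLeft_apply]

lemma aeval_seqShift_one_sub (a : ℂ) (v : ℕ → ℂ) (i : ℕ) :
    aeval seqShift (1 - C a * X) v i = v i - a * v (i + 1) := by
  simp [seqShift, LinearMap.funLeft_apply]

/-- The squared Euclidean norm of the first `n` entries of a sequence. -/
noncomputable def energy (n : ℕ) (v : ℕ → ℂ) : ℝ := ∑ i ∈ Finset.range n, ‖v i‖ ^ 2

/-- The monic polynomial with the given roots. -/
noncomputable def rootPoly (s : Multiset ℂ) : ℂ[X] := (s.map fun a => X - C a).prod

/-- The conjugate reciprocal of `rootPoly s`. -/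
noncomputable def reciprocalPoly (s : Multiset ℂ) : ℂ[X] :=
  (s.map fun a => 1 - C (conj a) * X).prod

lemma rootPoly_cons (a : ℂ) (s : Multiset ℂ) : rootPoly (a ::ₘ s) = (X - C a) * rootPoly s := by
  simp [rootPoly]

lemma reciprocalPoly_cons (a : ℂ) (s : Multiset ℂ) :
    reciprocalPoly (a ::ₘ s) = (1 - C (conj a) * X) * reciprocalPoly s := by
  simp [reciprocalPoly]

lemma reverse_map_rootPoly (s : Multiset ℂ) :
    ((rootPoly s).map (starRingEnd ℂ)).reverse = reciprocalPoly s := by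
  induction s using Multiset.induction_on with
  | empty => simpa [rootPoly, reciprocalPoly] using reverse_C (1 : ℂ)
  | cons a s ih =>
    rw [rootPoly_cons, reciprocalPoly_cons, Polynomial.map_mul, reverse_mul_of_domain, ih]
    congr 1
    have h : (X - C a).map (starRingEnd ℂ) = X - C (conj a) := by simp
    rw [h]
    ext j
    rw [coeff_reverse, natDegree_X_sub_C]
    rcases j with _ | _ | j
    · simp [revAt_le, coeff_X]
    · simp [revAt_le, coeff_one]
    · rw [← revAtFun_eq, revAtFun, if_neg (by omega)]
      simp [coeff_X, coeff_one]

lemma natDegree_reciprocalPoly_le (s : Multiset ℂ) :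
    (reciprocalPoly s).natDegree ≤ Multiset.card s := by
  rw [← reverse_map_rootPoly]
  refine (reverse_natDegree_le _).trans (natDegree_map_le.trans ?_)
  rw [rootPoly, natDegree_multiset_prod_X_sub_C_eq_card]

/-- For scalars, `|x - āy|² - |y - ax|² = (1 - |a|²)(|x|² - |y|²)`; along the sequence the right
side telescopes. -/
lemma energy_one_factor {n : ℕ} (a : ℂ) {v : ℕ → ℂ} (hv : v n = 0) :
    energy n (aeval seqShift (1 - C (conj a) * X) v) =
      energy n (aeval seqShift (X - C a) v) + (1 - ‖a‖ ^ 2) * ‖v 0‖ ^ 2 := by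
  have key : ∀ i, ‖v i - conj a * v (i + 1)‖ ^ 2 =
      ‖v (i + 1) - a * v i‖ ^ 2 + (1 - ‖a‖ ^ 2) * (‖v i‖ ^ 2 - ‖v (i + 1)‖ ^ 2) := by
    intro i
    simp only [← Complex.normSq_eq_norm_sq, Complex.normSq_apply]
    simp
    ring
  simp only [energy, aeval_seqShift_X_sub_C, aeval_seqShift_one_sub, key, Finset.sum_add_distrib,
    ← Finset.mul_sum]
  rw [Finset.sum_range_sub' fun i => ‖v i‖ ^ 2]
  simp [hv]

lemma energy_cons {n : ℕ} (a : ℂ) (s : Multiset ℂ) {v : ℕ → ℂ} (hv : ∀ i, n ≤ i → v i = 0) :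
    energy n (aeval seqShift (reciprocalPoly (a ::ₘ s)) v) =
      energy n (aeval seqShift (reciprocalPoly s) (aeval seqShift (X - C a) v)) +
        (1 - ‖a‖ ^ 2) * ‖aeval seqShift (reciprocalPoly s) v 0‖ ^ 2 := by
  rw [reciprocalPoly_cons, aeval_seqShift_mul,
    energy_one_factor a (aeval_seqShift_eq_zero_of_le _ hv n le_rfl), ← aeval_seqShift_mul,
    ← aeval_seqShift_mul, mul_comm]

lemma aeval_rootPoly_cons (a : ℂ) (s : Multiset ℂ) (v : ℕ → ℂ) :
    aeval seqShift (rootPoly (a ::ₘ s)) v =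
      aeval seqShift (rootPoly s) (aeval seqShift (X - C a) v) := by
  rw [rootPoly_cons, mul_comm, aeval_seqShift_mul]

/-- Each root peeled off by `energy_cons` adds a boundary term that reads only the initial entries
of `v`, and applying `X - C a` costs just one of the vanishing entries. -/
lemma energy_eq_of_vanishing {n : ℕ} (s : Multiset ℂ) {v : ℕ → ℂ} (hv : ∀ i, n ≤ i → v i = 0)
    (h : ∀ i, i < Multiset.card s → v i = 0) :
    energy n (aeval seqShift (reciprocalPoly s) v) = energy n (aeval seqShift (rootPoly s) v) := by
  induction s using Multiset.induction_on generalizing v with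
  | empty => simp [rootPoly, reciprocalPoly]
  | cons a s ih =>
    rw [Multiset.card_cons] at h
    rw [energy_cons a s hv, aeval_rootPoly_cons, ih (aeval_seqShift_eq_zero_of_le _ hv),
      aeval_seqShift_eq_zero_of_lt _ h 0 (by have := natDegree_reciprocalPoly_le s; omega)]
    · simp
    · exact fun i hi => aeval_seqShift_eq_zero_of_lt _ h i (by rw [natDegree_X_sub_C]; omega)

lemma energy_rootPoly_le {n : ℕ} (s : Multiset ℂ) (hs : ∀ a ∈ s, ‖a‖ < 1) {v : ℕ → ℂ}
    (hv : ∀ i, n ≤ i → v i = 0) :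
    energy n (aeval seqShift (rootPoly s) v) ≤ energy n (aeval seqShift (reciprocalPoly s) v) := by
  induction s using Multiset.induction_on generalizing v with
  | empty => simp [rootPoly, reciprocalPoly]
  | cons a s ih =>
    rw [energy_cons a s hv, aeval_rootPoly_cons]
    have h1 := ih (fun b hb => hs b (Multiset.mem_cons_of_mem hb))
      (aeval_seqShift_eq_zero_of_le (X - C a) hv)
    have ha : ‖a‖ ^ 2 < 1 := by
      have := hs a (Multiset.mem_cons_self a s)
      have := norm_nonneg a
      nlinarith
    have := mul_nonneg (sub_nonneg.2 ha.le) (sq_nonneg ‖aeval seqShift (reciprocalPoly s) v 0‖)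
    linarith

/-- On a geometric sequence the shift is multiplication by its ratio; every factor uses up one
entry, so geometric behaviour is needed only up to the degree. -/
lemma aeval_reciprocalPoly_geometric (s : Multiset ℂ) (b : ℂ) {v : ℕ → ℂ}
    (h : ∀ i, i < Multiset.card s → v (i + 1) = b * v i) :
    aeval seqShift (reciprocalPoly s) v 0 = (s.map fun a => 1 - conj a * b).prod * v 0 := by
  induction s using Multiset.induction_on generalizing v with
  | empty => simp [reciprocalPoly]
  | cons a s ih =>
    rw [Multiset.card_cons] at h
    rw [reciprocalPoly_cons, mul_comm, aeval_seqShift_mul, ih, aeval_seqShift_one_sub, zero_add,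
      ← zero_add 1, h 0 (by omega), Multiset.map_cons, Multiset.prod_cons]
    · ring
    · intro i hi
      rw [aeval_seqShift_one_sub, aeval_seqShift_one_sub, h i (by omega), h (i + 1) (by omega),
        h i (by omega)]
      ring

/-- Equality kills every nonnegative boundary term. By induction `v` is initially geometric of ratio
`a`, and the last boundary term is then `v 0` times factors `1 - b̄a`, nonzero inside the disc. -/
lemma eq_zero_of_energy_eq {n : ℕ} (s : Multiset ℂ) (hs : ∀ a ∈ s, ‖a‖ < 1) {v : ℕ → ℂ}
    (hv : ∀ i, n ≤ i → v i = 0)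
    (h : energy n (aeval seqShift (reciprocalPoly s) v) = energy n (aeval seqShift (rootPoly s) v)) :
    ∀ i, i < Multiset.card s → v i = 0 := by
  induction s using Multiset.induction_on generalizing v with
  | empty => simp
  | cons a s ih =>
    have hs' : ∀ b ∈ s, ‖b‖ < 1 := fun b hb => hs b (Multiset.mem_cons_of_mem hb)
    have ha1 : ‖a‖ < 1 := hs a (Multiset.mem_cons_self a s)
    have ha : 0 < 1 - ‖a‖ ^ 2 := by have := norm_nonneg a; nlinarith
    have hw := aeval_seqShift_eq_zero_of_le (X - C a) hv
    rw [energy_cons a s hv, aeval_rootPoly_cons] at h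
    have h1 := energy_rootPoly_le s hs' hw
    have h2 := mul_nonneg ha.le (sq_nonneg ‖aeval seqShift (reciprocalPoly s) v 0‖)
    have h3 : (1 - ‖a‖ ^ 2) * ‖aeval seqShift (reciprocalPoly s) v 0‖ ^ 2 = 0 := by linarith
    have h4 : aeval seqShift (reciprocalPoly s) v 0 = 0 := by simpa [ha.ne'] using h3
    have h5 := ih hs' hw (by linarith)
    have h6 : ∀ i, i < Multiset.card s → v (i + 1) = a * v i := fun i hi => by
      have := h5 i hi
      rwa [aeval_seqShift_X_sub_C, sub_eq_zero] at this
    rw [aeval_reciprocalPoly_geometric s a h6, mul_eq_zero] at h4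
    have h7 : v 0 = 0 := by
      refine h4.resolve_left fun h0 => ?_
      obtain ⟨b, hb, hb0⟩ := Multiset.mem_map.1 (Multiset.prod_eq_zero_iff.1 h0)
      have h8 : ‖conj b * a‖ = 1 := by rw [← sub_eq_zero.1 hb0, norm_one]
      rw [norm_mul, RCLike.norm_conj] at h8
      have := hs' b hb
      nlinarith [norm_nonneg a, norm_nonneg b]
    intro i
    induction i with
    | zero => exact fun _ => h7
    | succ i hi =>
      intro hlt
      rw [Multiset.card_cons] at hlt hi
      rw [h6 i (by omega), hi (by omega), mul_zero]

theorem energy_lt_iff {n : ℕ} (s : Multiset ℂ) (hn : Multiset.card s = n) :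
    (∀ v : ℕ → ℂ, (∀ i, n ≤ i → v i = 0) → v ≠ 0 →
      energy n (aeval seqShift (rootPoly s) v) < energy n (aeval seqShift (reciprocalPoly s) v)) ↔
      ∀ a ∈ s, ‖a‖ < 1 := by
  constructor
  · intro h a ha
    by_contra! hlt
    obtain ⟨s, rfl⟩ := Multiset.exists_cons_of_mem ha
    rw [Multiset.card_cons] at hn
    -- A truncated geometric sequence: `X - C a` annihilates its first `n - 1` entries, so only the
    -- boundary term of the bad root `a` remains, and its sign is wrong.
    set v : ℕ → ℂ := fun i => if i < n then a ^ i else 0 with hv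
    have hsupp : ∀ i, n ≤ i → v i = 0 := fun i hi => if_neg (by omega)
    have h0 : v ≠ 0 := fun h0 => by
      have := congrFun h0 0
      simp [hv, show 0 < n by omega] at this
    have h1 := h v hsupp h0
    rw [energy_cons a s hsupp, aeval_rootPoly_cons,
      energy_eq_of_vanishing s (aeval_seqShift_eq_zero_of_le _ hsupp)] at h1
    · have h2 : (1 - ‖a‖ ^ 2) ≤ 0 := by nlinarith
      have := mul_nonpos_of_nonpos_of_nonneg h2
        (sq_nonneg ‖aeval seqShift (reciprocalPoly s) v 0‖)
      linarith
    · intro i hi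
      rw [aeval_seqShift_X_sub_C]
      simp [hv, show i < n by omega, show i + 1 < n by omega, pow_succ, mul_comm]
  · intro hs v hv h0
    refine lt_of_le_of_ne (energy_rootPoly_le s hs hv) fun heq => h0 ?_
    ext i
    rcases lt_or_ge i n with hi | hi
    · exact eq_zero_of_energy_eq s hs hv heq.symm i (by omega)
    · exact hv i hi

/-- Extension of a finite vector by zero to a sequence. -/
def extendZero {n : ℕ} (v : Fin n → ℂ) (i : ℕ) : ℂ := if h : i < n then v ⟨i, h⟩ else 0

lemma extendZero_of_le {n : ℕ} (v : Fin n → ℂ) (i : ℕ) (hi : n ≤ i) : extendZero v i = 0 :=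
  dif_neg (by omega)

@[simp] lemma extendZero_val {n : ℕ} (v : Fin n → ℂ) (i : Fin n) : extendZero v i = v i := by
  simp [extendZero]

lemma sum_upper_eq_sum_range {n : ℕ} (c : ℕ → ℂ) (v : Fin n → ℂ) (i : Fin n) :
    ∑ j : Fin n, (if i ≤ j then c ((j : ℕ) - (i : ℕ)) else 0) * v j =
      ∑ j ∈ Finset.range (n + 1), c j * extendZero v (i + j) := by
  have h1 : ∑ j : Fin n, (if i ≤ j then c ((j : ℕ) - (i : ℕ)) else 0) * v j =
      ∑ j ∈ Finset.range n, (if (i : ℕ) ≤ j then c (j - (i : ℕ)) else 0) * extendZero v j := by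
    rw [Finset.sum_range]
    simp only [extendZero_val, Fin.val_fin_le]
  rw [h1, ← Finset.sum_range_add_sum_Ico _ i.2.le,
    Finset.sum_eq_zero (s := Finset.range i), zero_add, Finset.sum_Ico_eq_sum_range]
  · have h3 : Finset.range (n - i) ⊆ Finset.range (n + 1) := by
      intro j; simp only [Finset.mem_range]; omega
    refine Eq.trans (Finset.sum_congr rfl fun j _ => by simp) (Finset.sum_subset h3 ?_)
    intro j _ hj
    rw [extendZero_of_le _ _ (by have := Finset.mem_range.not.1 hj; omega), mul_zero]
  · intro j hj
    rw [if_neg (by have := Finset.mem_range.1 hj; omega), zero_mul]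

lemma star_dotProduct_self_eq_energy {n : ℕ} (w : Fin n → ℂ) (u : ℕ → ℂ)
    (h : ∀ i : Fin n, w i = u i) : star w ⬝ᵥ w = (energy n u : ℂ) := by
  simp only [dotProduct, Pi.star_apply, energy, Finset.sum_range, ← h]
  push_cast
  exact Finset.sum_congr rfl fun i _ => Complex.conj_mul' (w i)

/-- On zero-extended vectors the upper triangular Toeplitz matrices act as polynomials in the
backward shift; conjugating the top one yields the conjugate reciprocal polynomial. -/
lemma star_dotProduct_hermiteMatrix {n : ℕ} (s : Multiset ℂ) (hn : Multiset.card s = n)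
    (v : Fin n → ℂ) :
    star v ⬝ᵥ (hermiteMatrix n (rootPoly s) *ᵥ v) =
      ((energy n (aeval seqShift (reciprocalPoly s) (extendZero v)) -
        energy n (aeval seqShift (rootPoly s) (extendZero v)) : ℝ) : ℂ) := by
  have hdeg : (rootPoly s).natDegree = n := by
    rw [rootPoly, natDegree_multiset_prod_X_sub_C_eq_card, hn]
  have hT : (toeplitzTop n (rootPoly s))ᵀ = ((toeplitzTop n (rootPoly s)).map star)ᴴ := by
    ext i j; simp
  have hform : ∀ T : Matrix (Fin n) (Fin n) ℂ,
      star v ⬝ᵥ ((Tᴴ * T) *ᵥ v) = star (T *ᵥ v) ⬝ᵥ (T *ᵥ v) := fun T => by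
    rw [← Matrix.mulVec_mulVec, Matrix.dotProduct_mulVec, Matrix.star_mulVec]
  rw [hermiteMatrix, hT, Matrix.sub_mulVec, dotProduct_sub, hform, hform, Complex.ofReal_sub]
  congr 1
  · refine star_dotProduct_self_eq_energy _ _ fun i => ?_
    rw [aeval_seqShift_apply _ _ _ (Nat.lt_succ_of_le (natDegree_reciprocalPoly_le s)), hn,
      ← sum_upper_eq_sum_range]
    simp only [Matrix.mulVec, dotProduct]
    refine Finset.sum_congr rfl fun j _ => ?_
    congr 1
    simp only [Matrix.map_apply, toeplitzTop, Matrix.of_apply]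
    split_ifs with hij
    · rw [← reverse_map_rootPoly, coeff_reverse, natDegree_map, hdeg, revAt_le (by omega),
        coeff_map]
      rfl
    · simp
  · refine star_dotProduct_self_eq_energy _ _ fun i => ?_
    rw [aeval_seqShift_apply _ _ _ (Nat.lt_succ_of_le hdeg.le), ← sum_upper_eq_sum_range]
    simp [Matrix.mulVec, dotProduct, toeplitzBot]

lemma isHermitian_hermiteMatrix (n : ℕ) (p : ℂ[X]) : (hermiteMatrix n p).IsHermitian := by
  have hT : (toeplitzTop n p)ᵀ = ((toeplitzTop n p).map star)ᴴ := by ext i j; simp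
  rw [hermiteMatrix, hT]
  exact (Matrix.isHermitian_conjTranspose_mul_self _).sub
    (Matrix.isHermitian_conjTranspose_mul_self _)

/-- The Schur–Cohn criterion. -/
theorem hermiteMatrix_posDef_iff {n : ℕ} {p : ℂ[X]} (hp : p.Monic) (hn : p.natDegree = n) :
    (hermiteMatrix n p).PosDef ↔ ∀ a, p.IsRoot a → ‖a‖ < 1 := by
  have hsp : p.Splits := IsAlgClosed.splits p
  have hcard : Multiset.card p.roots = n := by rw [← hn, hsp.natDegree_eq_card_roots]
  have hpr : rootPoly p.roots = p := (hsp.eq_prod_roots_of_monic hp).symm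
  have hroot : (∀ a, p.IsRoot a → ‖a‖ < 1) ↔ ∀ a ∈ p.roots, ‖a‖ < 1 := by
    simp only [mem_roots hp.ne_zero]
  rw [hroot, ← energy_lt_iff p.roots hcard, Matrix.posDef_iff_dotProduct_mulVec]
  have hiff : ∀ v : Fin n → ℂ, 0 < star v ⬝ᵥ (hermiteMatrix n p *ᵥ v) ↔
      energy n (aeval seqShift (rootPoly p.roots) (extendZero v)) <
        energy n (aeval seqShift (reciprocalPoly p.roots) (extendZero v)) := fun v => by
    have := star_dotProduct_hermiteMatrix p.roots hcard v
    rw [hpr] at this ⊢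
    rw [this, Complex.zero_lt_real, sub_pos]
  constructor
  · rintro ⟨-, h⟩ v hv h0
    have hext : extendZero (fun i : Fin n => v i) = v := by
      ext i
      rcases lt_or_ge i n with hi | hi
      · simp [extendZero, hi]
      · rw [extendZero_of_le _ _ hi, hv i hi]
    have := (hiff fun i => v i).1 (h fun h1 => h0 ?_)
    · rwa [hext] at this
    · rw [← hext, h1]; ext i; simp [extendZero]
  · refine fun h => ⟨isHermitian_hermiteMatrix n p, fun v hv => (hiff v).2 (h _ ?_ ?_)⟩
    · exact extendZero_of_le v
    · exact fun h0 => hv (funext fun i => by rw [← extendZero_val v i, h0]; rfl)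

/-- The complex matrix `∑ k, z k • H k`. -/
noncomputable def symbolMatrix {m n : ℕ} (H : Fin m → Matrix (Fin n) (Fin n) ℝ) (z : Fin m → ℂ) :
    Matrix (Fin n) (Fin n) ℂ :=
  ∑ k, z k • (H k).map (fun a : ℝ => (a : ℂ))

lemma charPolynomial_eq {m n : ℕ} (H : Fin m → Matrix (Fin n) (Fin n) ℝ) (z : Fin m → ℂ) :
    charPolynomial H z = (-symbolMatrix H z).charpoly := by
  rw [charPolynomial, Matrix.charpoly, Matrix.charmatrix]
  congr 1
  rw [← symbolMatrix, sub_eq_add_neg]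
  congr 1
  · ext i j : 2
    simp [Matrix.scalar_apply, Matrix.one_apply, Matrix.diagonal_apply]
  · ext i j : 2
    simp

lemma eval_charPolynomial {m n : ℕ} (H : Fin m → Matrix (Fin n) (Fin n) ℝ) (z : Fin m → ℂ)
    (μ : ℂ) : (charPolynomial H z).eval μ =
      (μ • (1 : Matrix (Fin n) (Fin n) ℂ) + symbolMatrix H z).det := by
  rw [charPolynomial_eq, Matrix.eval_charpoly, Matrix.scalar_apply, sub_neg_eq_add,
    Matrix.smul_one_eq_diagonal]

lemma hermiteForm_posDef_iff {m n : ℕ} (H : Fin m → Matrix (Fin n) (Fin n) ℝ) (z : Fin m → ℂ) :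
    (hermiteForm H z).PosDef ↔
      ∀ μ : ℂ, (μ • (1 : Matrix (Fin n) (Fin n) ℂ) + symbolMatrix H z).det = 0 → ‖μ‖ < 1 := by
  rw [hermiteForm, hermiteMatrix_posDef_iff]
  · simp only [IsRoot.def, eval_charPolynomial]
  · rw [charPolynomial_eq]; exact Matrix.charpoly_monic _
  · rw [charPolynomial_eq, Matrix.charpoly_natDegree_eq_dim, Fintype.card_fin]

end SchurCohn

/-! ### Uniform decay of powers on the torus, and Cauchy estimates. -/

section PowerBounds

open Filter Topology
open scoped Matrix.Norms.Operator NNReal ENNReal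

lemma sum_rootsOfUnity_pow_div {L : ℕ} (hL : L ≠ 0) {ζ : ℂ} (hζ : IsPrimitiveRoot ζ L) {a b : ℕ}
    (ha : a < L) (hb : b < L) :
    ∑ j : Fin L, (ζ ^ (j : ℕ)) ^ a / (ζ ^ (j : ℕ)) ^ b = if a = b then (L : ℂ) else 0 := by
  have h0 : ζ ≠ 0 := hζ.ne_zero hL
  split_ifs with h
  · subst h
    rw [Finset.sum_congr rfl fun j _ => div_self (pow_ne_zero _ (pow_ne_zero _ h0))]
    simp
  · have h1 : ζ ^ a / ζ ^ b ≠ 1 := fun h2 =>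
      h (hζ.pow_inj ha hb ((div_eq_one_iff_eq (pow_ne_zero _ h0)).1 h2))
    have h2 : ∀ j : Fin L, (ζ ^ (j : ℕ)) ^ a / (ζ ^ (j : ℕ)) ^ b = (ζ ^ a / ζ ^ b) ^ (j : ℕ) := by
      intro j
      rw [div_pow, ← pow_mul, ← pow_mul, ← pow_mul, ← pow_mul, mul_comm a, mul_comm b]
    rw [Finset.sum_congr rfl fun j _ => h2 j, ← Finset.sum_range fun j => (ζ ^ a / ζ ^ b) ^ j,
      geom_sum_eq h1, div_pow, ← pow_mul, ← pow_mul, mul_comm a, mul_comm b, pow_mul, pow_mul,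
      hζ.pow_eq_one]
    simp

/-- Cauchy's estimate for a trigonometric polynomial on the torus. -/
lemma norm_coeff_le_of_torus {m : ℕ} {E : Type*} [NormedAddCommGroup E] [NormedSpace ℂ E]
    (S : Finset (Fin m → ℕ)) (b : (Fin m → ℕ) → E) {K : ℝ}
    (hK : ∀ z : Fin m → ℂ, (∀ k, ‖z k‖ = 1) → ‖∑ β ∈ S, (∏ k, z k ^ β k) • b β‖ ≤ K)
    {α : Fin m → ℕ} (hα : α ∈ S) : ‖b α‖ ≤ K := by
  classical
  -- `L` exceeds every exponent occurring in `S`, so a finite average over `L`-th roots of unity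
  -- isolates one coefficient without aliasing.
  set L : ℕ := (S.sup fun β => ∑ k, β k) + 1 with hLdef
  have hlt : ∀ β ∈ S, ∀ k, β k < L := fun β hβ k => Nat.lt_succ_of_le
    ((Finset.single_le_sum (f := fun k => β k) (fun _ _ => Nat.zero_le _)
      (Finset.mem_univ k)).trans (Finset.le_sup (f := fun β : Fin m → ℕ => ∑ k, β k) hβ))
  have hL : L ≠ 0 := Nat.succ_ne_zero _
  obtain ⟨ζ, hζ⟩ : ∃ ζ : ℂ, IsPrimitiveRoot ζ L := ⟨_, Complex.isPrimitiveRoot_exp L hL⟩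
  have hnorm : ∀ j : ℕ, ‖ζ ^ j‖ = 1 := fun j => by
    rw [norm_pow, hζ.norm'_eq_one hL, one_pow]
  have hsum : ∑ x : Fin m → Fin L, (∏ k, (ζ ^ (x k : ℕ)) ^ α k)⁻¹ •
      ∑ β ∈ S, (∏ k, (ζ ^ (x k : ℕ)) ^ β k) • b β = ((L : ℂ) ^ m) • b α := by
    simp only [Finset.smul_sum, smul_smul]
    rw [Finset.sum_comm]
    simp only [← Finset.sum_smul]
    rw [Finset.sum_eq_single α]
    · congr 1
      rw [Finset.sum_congr rfl fun x _ => inv_mul_cancel₀ (Finset.prod_ne_zero_iff.2 fun k _ =>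
        pow_ne_zero _ (pow_ne_zero _ (hζ.ne_zero hL)))]
      simp
    · intro β hβ hne
      have h1 : ∀ x : Fin m → Fin L, (∏ k, (ζ ^ (x k : ℕ)) ^ α k)⁻¹ *
          ∏ k, (ζ ^ (x k : ℕ)) ^ β k = ∏ k, (ζ ^ (x k : ℕ)) ^ β k / (ζ ^ (x k : ℕ)) ^ α k := by
        intro x
        rw [Finset.prod_div_distrib, div_eq_mul_inv, mul_comm]
      rw [Finset.sum_congr rfl fun x _ => h1 x,
        ← Fintype.prod_sum fun k (j : Fin L) => (ζ ^ (j : ℕ)) ^ β k / (ζ ^ (j : ℕ)) ^ α k]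
      obtain ⟨k, hk⟩ := Function.ne_iff.1 hne
      rw [Finset.prod_eq_zero (Finset.mem_univ k), zero_smul]
      rw [sum_rootsOfUnity_pow_div hL hζ (hlt β hβ k) (hlt α hα k), if_neg hk]
    · exact fun h => absurd hα h
  have hle : ‖((L : ℂ) ^ m) • b α‖ ≤ (L : ℝ) ^ m * K := by
    rw [← hsum]
    refine (norm_sum_le _ _).trans ((Finset.sum_le_card_nsmul _ _ K fun x _ => ?_).trans_eq ?_)
    · rw [norm_smul, norm_inv, norm_prod]
      simp only [norm_pow, hζ.norm'_eq_one hL, one_pow, Finset.prod_const_one, inv_one, one_mul]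
      exact hK _ fun k => hnorm _
    · simp
  rw [norm_smul, norm_pow, Complex.norm_natCast] at hle
  exact le_of_mul_le_mul_left hle (by positivity)

/-- If every element `∑ k, z k • B k` with `z` on the torus has its spectrum in the open unit disc,
then its powers decay geometrically, uniformly on the torus. -/
lemma exists_norm_torus_pow_le {m : ℕ} {A : Type*} [NormedRing A] [NormedAlgebra ℂ A]
    [CompleteSpace A] [Nontrivial A] (B : Fin m → A)
    (h : ∀ z : Fin m → ℂ, (∀ k, ‖z k‖ = 1) → ∀ μ ∈ spectrum ℂ (∑ k, z k • B k), ‖μ‖ < 1) :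
    ∃ q : ℝ, 0 < q ∧ q < 1 ∧ ∀ᶠ N : ℕ in atTop, ∀ z : Fin m → ℂ, (∀ k, ‖z k‖ = 1) →
      ‖(∑ k, z k • B k) ^ N‖ ≤ q ^ N := by
  -- Invertibility in this algebra is pointwise, so its spectrum comes from the pointwise spectra,
  -- while Gelfand's formula for the sup norm is automatically uniform in `z`.
  let a : C(Fin m → Circle, A) := ⟨fun z => ∑ k, (z k : ℂ) • B k, by fun_prop⟩
  have : Nontrivial C(Fin m → Circle, A) :=
    ⟨⟨1, 0, fun h01 => one_ne_zero (congrArg (fun f : C(Fin m → Circle, A) => f fun _ => 1) h01)⟩⟩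
  have hspec : ∀ μ ∈ spectrum ℂ a, ‖μ‖₊ < 1 := by
    intro μ hμ
    rw [spectrum.mem_iff, ContinuousMap.isUnit_iff_forall_isUnit] at hμ
    push Not at hμ
    obtain ⟨z, hz⟩ := hμ
    exact h (fun k => (z k : ℂ)) (fun k => Circle.norm_coe _) μ hz
  have hrad : spectralRadius ℂ a < (1 : ℝ≥0) := spectrum.spectralRadius_lt_of_forall_lt a hspec
  obtain ⟨q, hq1, hq2⟩ := ENNReal.lt_iff_exists_nnreal_btwn.1 hrad
  refine ⟨q, ?_, by exact_mod_cast hq2, ?_⟩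
  · have : (0 : ℝ≥0∞) < q := bot_le.trans_lt hq1
    exact_mod_cast this
  have hev := (spectrum.pow_nnnorm_pow_one_div_tendsto_nhds_spectralRadius a).eventually_lt_const
    hq1
  filter_upwards [hev, eventually_gt_atTop 0] with N hN hN0 z hz
  have h1 : ‖a ^ N‖ ≤ (q : ℝ) ^ N := by
    have h2 : (‖a ^ N‖₊ : ℝ≥0∞) ≤ (q : ℝ≥0∞) ^ N := by
      have := ENNReal.rpow_le_rpow hN.le (z := (N : ℝ)) (by positivity)
      rwa [← ENNReal.rpow_mul, one_div_mul_cancel (by positivity), ENNReal.rpow_one,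
        ENNReal.rpow_natCast] at this
    exact_mod_cast h2
  refine le_trans ?_ h1
  have h3 := (a ^ N).norm_coe_le_norm fun k =>
    (⟨z k, by simpa [Submonoid.unitSphere] using hz k⟩ : Circle)
  rwa [ContinuousMap.coe_pow] at h3

lemma exists_norm_symbolMatrix_pow_le {m n : ℕ} (H : Fin m → Matrix (Fin n) (Fin n) ℝ)
    (h : ∀ z : Fin m → ℂ, (∀ k, ‖z k‖ = 1) → ∀ μ : ℂ,
      (μ • (1 : Matrix (Fin n) (Fin n) ℂ) + symbolMatrix H z).det = 0 → ‖μ‖ < 1) :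
    ∃ q : ℝ, 0 < q ∧ q < 1 ∧ ∀ᶠ N : ℕ in atTop, ∀ z : Fin m → ℂ, (∀ k, ‖z k‖ = 1) →
      ‖(-symbolMatrix H z) ^ N‖ ≤ q ^ N := by
  rcases Nat.eq_zero_or_pos n with rfl | hn
  · refine ⟨1 / 2, by norm_num, by norm_num, Eventually.of_forall fun N z _ => ?_⟩
    rw [Subsingleton.elim ((-symbolMatrix H z) ^ N) 0, norm_zero]
    positivity
  have : Nonempty (Fin n) := ⟨⟨0, hn⟩⟩
  have hneg : ∀ z : Fin m → ℂ,
      -symbolMatrix H z = ∑ k, z k • (-(H k).map (fun a : ℝ => (a : ℂ))) := fun z => by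
    simp [symbolMatrix]
  have : CompleteSpace (Matrix (Fin n) (Fin n) ℂ) := FiniteDimensional.complete ℂ _
  simp only [hneg]
  refine exists_norm_torus_pow_le _ fun z hz μ hμ => h z hz μ ?_
  by_contra h0
  refine hμ ((Matrix.isUnit_iff_isUnit_det _).2 (isUnit_iff_ne_zero.2 ?_))
  rwa [← hneg, sub_neg_eq_add, Algebra.algebraMap_eq_smul_one]

end PowerBounds

/-! ### Delay polynomials, acting both on the torus and on functions of time. -/

section Delays

open Filter Topology AddMonoidAlgebra
open scoped Matrix.Norms.Operator

/-- The formal delay operator `-∑ k, H k X_k`, as a polynomial with matrix coefficients. -/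
noncomputable def delayPoly {m n : ℕ} (H : Fin m → Matrix (Fin n) (Fin n) ℝ) :
    AddMonoidAlgebra (Matrix (Fin n) (Fin n) ℝ) (Fin m → ℕ) :=
  ∑ k, single (Pi.single k 1) (-H k)

/-- Homogeneity of the powers: it bounds the number of monomials, and it puts every total delay in
the `N`-th power between `N` times the least and `N` times the largest delay. -/
lemma sum_eq_of_mem_support_delayPoly_pow {m n : ℕ} (H : Fin m → Matrix (Fin n) (Fin n) ℝ) (N : ℕ) :
    ∀ α ∈ (delayPoly H ^ N).coeff.support, ∑ k, α k = N := by
  classical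
  induction N with
  | zero =>
    intro α hα
    have := support_coeff_one_subset (by simpa using hα)
    rw [Finset.mem_zero] at this
    simp [this]
  | succ N ih =>
    intro α hα
    rw [pow_succ] at hα
    obtain ⟨β, hβ, γ, hγ, rfl⟩ := Finset.mem_add.1 (support_coeff_mul_subset _ _ hα)
    have h1 : γ ∈ Finset.univ.biUnion fun k : Fin m =>
        (single (Pi.single k 1 : Fin m → ℕ) (-H k)).coeff.support := by
      refine Finsupp.support_finsetSum ?_
      rw [delayPoly] at hγ
      convert! hγ
      exact (map_sum coeffAddEquiv _ _).symm
    obtain ⟨k, -, hk⟩ := Finset.mem_biUnion.1 h1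
    rw [coeff_single] at hk
    have := Finsupp.support_single_subset hk
    rw [Finset.mem_singleton] at this
    simp [this, Finset.sum_add_distrib, ih β hβ]

lemma card_support_delayPoly_pow_le {m n : ℕ} (H : Fin m → Matrix (Fin n) (Fin n) ℝ) (N : ℕ) :
    (delayPoly H ^ N).coeff.support.card ≤ (N + 1) ^ m := by
  have : (delayPoly H ^ N).coeff.support ⊆ Fintype.piFinset fun _ => Finset.range (N + 1) := by
    intro α hα
    rw [Fintype.mem_piFinset]
    intro k
    rw [Finset.mem_range, Nat.lt_succ_iff, ← sum_eq_of_mem_support_delayPoly_pow H N α hα]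
    exact Finset.single_le_sum (f := fun k => α k) (fun _ _ => Nat.zero_le _) (Finset.mem_univ k)
  simpa using Finset.card_le_card this

lemma liftNCRingHom_apply {k G R : Type*} [Semiring k] [AddMonoid G] [Semiring R] (f : k →+* R)
    (g : Multiplicative G →* R) (h_comm) (c : AddMonoidAlgebra k G) :
    liftNCRingHom f g h_comm c =
      ∑ α ∈ c.coeff.support, f (c.coeff α) * g (Multiplicative.ofAdd α) := by
  conv_lhs => rw [← sum_coeff_single c]
  rw [Finsupp.sum, map_sum]
  simp

/-- Substitution of complex numbers for the variables of a polynomial with matrix coefficients. -/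
noncomputable def torusEval {m : ℕ} (n : ℕ) (z : Fin m → ℂ) :
    AddMonoidAlgebra (Matrix (Fin n) (Fin n) ℝ) (Fin m → ℕ) →+* Matrix (Fin n) (Fin n) ℂ :=
  liftNCRingHom Complex.ofRealHom.mapMatrix
    { toFun := fun α => (∏ k, z k ^ (Multiplicative.toAdd α) k) • 1
      map_one' := by simp
      map_mul' := fun α β => by simp [pow_add, Finset.prod_mul_distrib, smul_smul, mul_comm] }
    fun M α => (Commute.one_right _).smul_right _

lemma torusEval_apply {m n : ℕ} (z : Fin m → ℂ)
    (c : AddMonoidAlgebra (Matrix (Fin n) (Fin n) ℝ) (Fin m → ℕ)) :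
    torusEval n z c =
      ∑ α ∈ c.coeff.support, (∏ k, z k ^ α k) • Complex.ofRealHom.mapMatrix (c.coeff α) := by
  rw [torusEval, liftNCRingHom_apply]
  simp

lemma torusEval_delayPoly {m n : ℕ} (H : Fin m → Matrix (Fin n) (Fin n) ℝ) (z : Fin m → ℂ) :
    torusEval n z (delayPoly H) = -symbolMatrix H z := by
  classical
  rw [delayPoly, map_sum, symbolMatrix, ← Finset.sum_neg_distrib]
  refine Finset.sum_congr rfl fun k _ => ?_
  have : ∏ l, z l ^ (Pi.single k 1 : Fin m → ℕ) l = z k := by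
    rw [Finset.prod_eq_single k] <;> simp +contextual
  rw [torusEval, liftNCRingHom_single]
  ext i j
  simp [this]

lemma norm_mapMatrix_ofReal {n : ℕ} (M : Matrix (Fin n) (Fin n) ℝ) :
    ‖Complex.ofRealHom.mapMatrix M‖ = ‖M‖ := by
  simp only [Matrix.linfty_opNorm_def]
  simp

/-- Matrices acting pointwise on vector-valued functions. -/
def pointwiseMulVec (n : ℕ) :
    Matrix (Fin n) (Fin n) ℝ →+* Module.End ℝ (ℝ → Fin n → ℝ) where
  toFun := fun M =>
    { toFun := fun u t => M *ᵥ u t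
      map_add' := fun u v => by ext1 t; exact Matrix.mulVec_add M (u t) (v t)
      map_smul' := fun c u => by ext1 t; exact Matrix.mulVec_smul M c (u t) }
  map_one' := by ext1 u; ext1 t; exact Matrix.one_mulVec (u t)
  map_mul' := fun M M' => by ext1 u; ext1 t; exact (Matrix.mulVec_mulVec (u t) M M').symm
  map_zero' := by ext1 u; ext1 t; exact Matrix.zero_mulVec (u t)
  map_add' := fun M M' => by ext1 u; ext1 t; exact Matrix.add_mulVec M M' (u t)

/-- Exponents acting on vector-valued functions by the corresponding combination of delays. -/
def delayTranslate {m : ℕ} (n : ℕ) (τ : Fin m → ℝ) :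
    Multiplicative (Fin m → ℕ) →* Module.End ℝ (ℝ → Fin n → ℝ) where
  toFun := fun α =>
    LinearMap.funLeft ℝ (Fin n → ℝ) fun t => t - ∑ k, (Multiplicative.toAdd α) k * τ k
  map_one' := by ext1 u; ext1 t; simp [LinearMap.funLeft_apply]
  map_mul' := fun α β => by
    ext1 u; ext1 t
    simp [LinearMap.funLeft_apply, add_mul, Finset.sum_add_distrib, sub_sub]

lemma commute_pointwiseMulVec_delayTranslate {m n : ℕ} (τ : Fin m → ℝ)
    (M : Matrix (Fin n) (Fin n) ℝ) (α : Multiplicative (Fin m → ℕ)) :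
    Commute (pointwiseMulVec n M) (delayTranslate n τ α) := rfl

/-- Substitution of delay operators for the variables of a polynomial with matrix coefficients. -/
noncomputable def delayEval {m : ℕ} (n : ℕ) (τ : Fin m → ℝ) :
    AddMonoidAlgebra (Matrix (Fin n) (Fin n) ℝ) (Fin m → ℕ) →+*
      Module.End ℝ (ℝ → Fin n → ℝ) :=
  liftNCRingHom (pointwiseMulVec n) (delayTranslate n τ)
    (commute_pointwiseMulVec_delayTranslate τ)

lemma delayEval_apply {m n : ℕ} (τ : Fin m → ℝ)
    (c : AddMonoidAlgebra (Matrix (Fin n) (Fin n) ℝ) (Fin m → ℕ)) (u : ℝ → Fin n → ℝ) (t : ℝ) :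
    delayEval n τ c u t = ∑ α ∈ c.coeff.support, c.coeff α *ᵥ u (t - ∑ k, α k * τ k) := by
  rw [delayEval, liftNCRingHom_apply, LinearMap.sum_apply, Finset.sum_apply]
  rfl

lemma delayEval_delayPoly {m n : ℕ} (H : Fin m → Matrix (Fin n) (Fin n) ℝ) (τ : Fin m → ℝ)
    (u : ℝ → Fin n → ℝ) (t : ℝ) :
    delayEval n τ (delayPoly H) u t = -∑ k, H k *ᵥ u (t - τ k) := by
  classical
  rw [delayPoly, map_sum, LinearMap.sum_apply, Finset.sum_apply, ← Finset.sum_neg_distrib]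
  refine Finset.sum_congr rfl fun k _ => ?_
  have : ∑ l, ((Pi.single k 1 : Fin m → ℕ) l : ℝ) * τ l = τ k := by
    rw [Finset.sum_eq_single k] <;> simp +contextual
  rw [delayEval, liftNCRingHom_single]
  change (-H k) *ᵥ u (t - ∑ l, ((Pi.single k 1 : Fin m → ℕ) l : ℝ) * τ l) = _
  rw [this, Matrix.neg_mulVec]

/-- The coefficients of the powers of the delay polynomial are summed geometrically. -/
lemma exists_sum_norm_coeff_delayPoly_pow_le {m n : ℕ} (H : Fin m → Matrix (Fin n) (Fin n) ℝ)
    (h : ∀ z : Fin m → ℂ, (∀ k, ‖z k‖ = 1) → ∀ μ : ℂ,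
      (μ • (1 : Matrix (Fin n) (Fin n) ℂ) + symbolMatrix H z).det = 0 → ‖μ‖ < 1) :
    ∃ D s : ℝ, 0 < s ∧ s < 1 ∧ 0 ≤ D ∧ ∀ N : ℕ,
      ∑ α ∈ (delayPoly H ^ N).coeff.support, ‖(delayPoly H ^ N).coeff α‖ ≤ D * s ^ N := by
  obtain ⟨q, hq0, hq1, hq⟩ := exists_norm_symbolMatrix_pow_le H h
  -- The gap between `q` and `s` absorbs the polynomial number of monomials.
  obtain ⟨s, hqs, hs1⟩ := exists_between hq1
  have hs0 := hq0.trans hqs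
  set b : ℕ → ℝ := fun N =>
    ∑ α ∈ (delayPoly H ^ N).coeff.support, ‖(delayPoly H ^ N).coeff α‖ with hb
  have hb0 : ∀ N, 0 ≤ b N := fun N => Finset.sum_nonneg fun _ _ => norm_nonneg _
  have hbound : ∀ᶠ N in atTop, b N / s ^ N ≤ 2 ^ m * ((N : ℝ) ^ m * (q / s) ^ N) := by
    filter_upwards [hq, eventually_ge_atTop 1] with N hN hN1
    have h1 : ∀ α ∈ (delayPoly H ^ N).coeff.support, ‖(delayPoly H ^ N).coeff α‖ ≤ q ^ N := by
      intro α hα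
      rw [← norm_mapMatrix_ofReal]
      refine norm_coeff_le_of_torus (delayPoly H ^ N).coeff.support
        (fun β => Complex.ofRealHom.mapMatrix ((delayPoly H ^ N).coeff β)) (fun z hz => ?_) hα
      rw [← torusEval_apply, map_pow, torusEval_delayPoly]
      exact hN z hz
    have h2 : b N ≤ ((N : ℝ) + 1) ^ m * q ^ N := by
      refine (Finset.sum_le_card_nsmul _ _ _ h1).trans ?_
      rw [nsmul_eq_mul]
      gcongr
      exact_mod_cast card_support_delayPoly_pow_le H N
    have h3 : ((N : ℝ) + 1) ^ m ≤ 2 ^ m * (N : ℝ) ^ m := by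
      rw [← mul_pow]
      gcongr
      have : (1 : ℝ) ≤ N := by exact_mod_cast hN1
      linarith
    rw [div_pow, ← mul_assoc, mul_div_assoc', div_le_div_iff_of_pos_right (by positivity)]
    exact h2.trans (by gcongr)
  have hlim : Tendsto (fun N => b N / s ^ N) atTop (𝓝 0) := by
    refine tendsto_of_tendsto_of_tendsto_of_le_of_le' tendsto_const_nhds ?_
      (Eventually.of_forall fun N => div_nonneg (hb0 N) (by positivity)) hbound
    simpa using (tendsto_pow_const_mul_const_pow_of_lt_one m (r := q / s) (by positivity)
      ((div_lt_one hs0).2 hqs)).const_mul ((2 : ℝ) ^ m)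
  obtain ⟨D, hD⟩ := hlim.bddAbove_range
  refine ⟨D, s, hs0, hs1, ?_, fun N => ?_⟩
  · exact (div_nonneg (hb0 0) (by positivity)).trans (hD ⟨0, rfl⟩)
  · exact (div_le_iff₀ (by positivity)).1 (hD ⟨N, rfl⟩)

end Delays

/-! ### Exponential stability from the finite Neumann expansion. -/

section Sufficiency

open Filter Topology AddMonoidAlgebra
open scoped Matrix.Norms.Operator

lemma le_maxDelay {m : ℕ} (τ : Fin m → ℝ) (k : Fin m) : τ k ≤ maxDelay τ :=
  le_ciSup (Set.finite_range τ).bddAbove k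

lemma maxDelay_nonneg {m : ℕ} {τ : Fin m → ℝ} (hτ : ∀ k, 0 < τ k) : 0 ≤ maxDelay τ :=
  Real.iSup_nonneg fun k => (hτ k).le

lemma exists_pos_le {m : ℕ} {τ : Fin m → ℝ} (hτ : ∀ k, 0 < τ k) : ∃ c, 0 < c ∧ ∀ k, c ≤ τ k := by
  rcases isEmpty_or_nonempty (Fin m) with h | h
  · exact ⟨1, one_pos, fun k => h.elim k⟩
  · obtain ⟨k, hk⟩ := Finite.exists_min τ
    exact ⟨τ k, hτ k, hk⟩

lemma eq_sum_pow_add {R M : Type*} [Semiring R] [AddCommMonoid M] [Module R M] (A : R)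
    {x f : M} (h : x = f + A • x) (N : ℕ) :
    x = ∑ j ∈ Finset.range N, A ^ j • f + A ^ N • x := by
  induction N with
  | zero => simp
  | succ N ih =>
    rw [Finset.sum_range_succ, add_assoc, pow_succ, mul_smul, ← smul_add, ← h]
    exact ih

/-- The part of a function on `[0, ∞)`, extended by zero. -/
noncomputable def forwardPart {n : ℕ} (x : ℝ → Fin n → ℝ) (t : ℝ) : Fin n → ℝ :=
  if 0 ≤ t then x t else 0

/-- The contribution of the initial data to the equation on `[0, ∞)`. -/
noncomputable def forcing {m n : ℕ} (H : Fin m → Matrix (Fin n) (Fin n) ℝ) (τ : Fin m → ℝ)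
    (x : ℝ → Fin n → ℝ) (t : ℝ) : Fin n → ℝ :=
  if 0 ≤ t then -∑ k, if t < τ k then H k *ᵥ x (t - τ k) else 0 else 0

/-- Truncation at time zero moves the initial data into a forcing term, making the equation valid on
the whole line, where delay operators can be iterated. -/
lemma forwardPart_eq {m n : ℕ} {H : Fin m → Matrix (Fin n) (Fin n) ℝ} {τ : Fin m → ℝ}
    (hτ : ∀ k, 0 < τ k) {x : ℝ → Fin n → ℝ} (hx : IsSolution H τ x) :
    forwardPart x = forcing H τ x + delayEval n τ (delayPoly H) • forwardPart x := by
  ext1 t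
  rw [Pi.add_apply, Module.End.smul_def, delayEval_delayPoly]
  by_cases ht : 0 ≤ t
  · simp only [forwardPart, forcing, if_pos ht]
    rw [← neg_add, ← Finset.sum_add_distrib, eq_neg_iff_add_eq_zero]
    refine Eq.trans ?_ (hx.equation t ht)
    congr 1
    refine Finset.sum_congr rfl fun k _ => ?_
    by_cases hk : t < τ k
    · rw [if_pos hk, if_neg (by linarith), Matrix.mulVec_zero, add_zero]
    · rw [if_neg hk, if_pos (by linarith), zero_add]
  · simp only [forwardPart, forcing, if_neg ht, zero_add]
    rw [eq_comm, neg_eq_zero]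
    refine Finset.sum_eq_zero fun k _ => ?_
    rw [if_neg (by linarith [hτ k]), Matrix.mulVec_zero]

lemma norm_forcing_le {m n : ℕ} (H : Fin m → Matrix (Fin n) (Fin n) ℝ) (τ : Fin m → ℝ)
    (x : ℝ → Fin n → ℝ) {B : ℝ} (hB0 : 0 ≤ B)
    (hB : ∀ s ∈ Set.Icc (-maxDelay τ) 0, ‖x s‖ ≤ B) (t : ℝ) :
    ‖forcing H τ x t‖ ≤ (∑ k, ‖H k‖) * B := by
  have h0 : 0 ≤ (∑ k, ‖H k‖) * B := mul_nonneg (Finset.sum_nonneg fun _ _ => norm_nonneg _) hB0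
  rw [forcing]
  split_ifs with ht
  · rw [norm_neg, Finset.sum_mul]
    refine (norm_sum_le _ _).trans (Finset.sum_le_sum fun k _ => ?_)
    split_ifs with hk
    · refine (Matrix.linfty_opNorm_mulVec _ _).trans ?_
      gcongr
      exact hB _ ⟨by linarith [le_maxDelay τ k], by linarith⟩
    · rw [norm_zero]; positivity
  · rwa [norm_zero]

lemma forcing_eq_zero {m n : ℕ} (H : Fin m → Matrix (Fin n) (Fin n) ℝ) (τ : Fin m → ℝ)
    (x : ℝ → Fin n → ℝ) {t : ℝ} (ht : maxDelay τ ≤ t) : forcing H τ x t = 0 := by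
  rw [forcing]
  split_ifs
  · rw [Finset.sum_eq_zero, neg_zero]
    exact fun k _ => if_neg (by linarith [le_maxDelay τ k])
  · rfl

theorem exponentiallyStable_of_det_ne_zero {m n : ℕ} {H : Fin m → Matrix (Fin n) (Fin n) ℝ}
    (h : ∀ z : Fin m → ℂ, (∀ k, ‖z k‖ = 1) → ∀ μ : ℂ,
      (μ • (1 : Matrix (Fin n) (Fin n) ℂ) + symbolMatrix H z).det = 0 → ‖μ‖ < 1)
    {τ : Fin m → ℝ} (hτ : ∀ k, 0 < τ k) : ExponentiallyStable H τ := by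
  obtain ⟨D, s, hs0, hs1, hD0, hD⟩ := exists_sum_norm_coeff_delayPoly_pow_le H h
  obtain ⟨c, hc0, hc⟩ := exists_pos_le hτ
  have hr := maxDelay_nonneg hτ
  -- The added one keeps `R` positive when there are no delays.
  set R : ℝ := maxDelay τ + 1 with hR
  have hR0 : 0 < R := by linarith
  -- With this choice `s = w * w`: one factor `w ^ j` pays for decay in time, the other for
  -- summation over `j`.
  set β : ℝ := -Real.log s / 2 with hβ
  have hβ0 : 0 < β := by have := Real.log_neg hs0 hs1; rw [hβ]; linarith
  set w : ℝ := Real.exp (-β) with hw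
  have hw0 : 0 < w := Real.exp_pos _
  have hw1 : w < 1 := Real.exp_lt_one_iff.2 (by linarith)
  have hsw : s = w * w := by
    rw [hw, ← Real.exp_add, show -β + -β = Real.log s by rw [hβ]; ring, Real.exp_log hs0]
  set h₀ : ℝ := ∑ k, ‖H k‖ with hh
  have hh0 : 0 ≤ h₀ := Finset.sum_nonneg fun _ _ => norm_nonneg _
  refine ⟨D * h₀ * Real.exp β * (1 - w)⁻¹, β / R, by positivity, fun x hx B hB t ht => ?_⟩
  have hB0 : 0 ≤ B := (norm_nonneg _).trans (hB 0 ⟨by linarith, le_rfl⟩)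
  have hshift : ∀ N : ℕ, ∀ α ∈ (delayPoly H ^ N).coeff.support,
      N * c ≤ ∑ k, α k * τ k ∧ ∑ k, α k * τ k ≤ N * maxDelay τ := by
    intro N α hα
    rw [← sum_eq_of_mem_support_delayPoly_pow H N α hα]
    push_cast
    rw [Finset.sum_mul, Finset.sum_mul]
    exact ⟨Finset.sum_le_sum fun k _ => by gcongr; exact hc k,
      Finset.sum_le_sum fun k _ => by gcongr; exact le_maxDelay τ k⟩
  have hterm : ∀ j : ℕ, ‖delayEval n τ (delayPoly H ^ j) (forcing H τ x) t‖ ≤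
      D * h₀ * B * Real.exp β * Real.exp (-(β / R) * t) * w ^ j := by
    intro j
    rw [delayEval_apply]
    -- For such late times the `j`-th term samples the forcing only past its support.
    rcases le_or_gt ((j + 1) * R) t with hj | hj
    · rw [Finset.sum_eq_zero, norm_zero]
      · positivity
      · intro α hα
        rw [forcing_eq_zero, Matrix.mulVec_zero]
        have := (hshift j α hα).2
        have h1 : (j : ℝ) * maxDelay τ + maxDelay τ ≤ (j + 1) * R := by
          rw [hR]; nlinarith [(Nat.cast_nonneg j : (0 : ℝ) ≤ j)]
        linarith
    · have h1 : ‖∑ α ∈ (delayPoly H ^ j).coeff.support,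
          (delayPoly H ^ j).coeff α *ᵥ forcing H τ x (t - ∑ k, α k * τ k)‖ ≤
          D * s ^ j * (h₀ * B) := by
        refine (norm_sum_le _ _).trans (le_trans (Finset.sum_le_sum fun α _ =>
          (Matrix.linfty_opNorm_mulVec _ _).trans
            (mul_le_mul_of_nonneg_left (norm_forcing_le H τ x hB0 hB _) (norm_nonneg _))) ?_)
        rw [← Finset.sum_mul]
        exact mul_le_mul_of_nonneg_right (hD j) (by positivity)
      have h2 : w ^ j ≤ Real.exp β * Real.exp (-(β / R) * t) := by
        rw [hw, ← Real.exp_nat_mul, ← Real.exp_add, Real.exp_le_exp]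
        have : β / R * t ≤ β / R * ((j + 1) * R) := by gcongr
        have h3 : β / R * ((j + 1) * R) = β * (j + 1) := by field_simp
        linarith
      calc _ ≤ D * s ^ j * (h₀ * B) := h1
        _ = D * h₀ * B * w ^ j * w ^ j := by rw [hsw, mul_pow]; ring
        _ ≤ D * h₀ * B * (Real.exp β * Real.exp (-(β / R) * t)) * w ^ j := by gcongr
        _ = _ := by ring
  -- Once `N * c > t`, the Neumann remainder at `t` reads `forwardPart x` only at negative times, so
  -- it vanishes.
  obtain ⟨N, hN⟩ := exists_nat_gt (t / c)
  rw [div_lt_iff₀ hc0] at hN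
  have hxt : x t = ∑ j ∈ Finset.range N, delayEval n τ (delayPoly H ^ j) (forcing H τ x) t := by
    have h1 := congrFun (eq_sum_pow_add _ (forwardPart_eq hτ hx) N) t
    have h2 : (delayEval n τ (delayPoly H) ^ N • forwardPart x) t = 0 := by
      rw [← map_pow, Module.End.smul_def, delayEval_apply]
      refine Finset.sum_eq_zero fun α hα => ?_
      rw [forwardPart, if_neg (by linarith [(hshift N α hα).1]), Matrix.mulVec_zero]
    rw [Pi.add_apply, h2, add_zero, Finset.sum_apply, forwardPart, if_pos ht] at h1
    rw [h1]
    exact Finset.sum_congr rfl fun j _ => by rw [← map_pow, Module.End.smul_def]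
  have hgeom : ∑ j ∈ Finset.range N, w ^ j ≤ (1 - w)⁻¹ := by
    rw [← tsum_geometric_of_lt_one hw0.le hw1]
    exact (summable_geometric_of_lt_one hw0.le hw1).sum_le_tsum _ fun j _ => by positivity
  calc ‖x t‖ ≤ ∑ j ∈ Finset.range N,
        D * h₀ * B * Real.exp β * Real.exp (-(β / R) * t) * w ^ j := by
        rw [hxt]
        exact (norm_sum_le _ _).trans (Finset.sum_le_sum fun j _ => hterm j)
    _ ≤ D * h₀ * B * Real.exp β * Real.exp (-(β / R) * t) * (1 - w)⁻¹ := by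
        rw [← Finset.mul_sum]
        exact mul_le_mul_of_nonneg_left hgeom (by positivity)
    _ = _ := by ring

end Sufficiency

/-! ### Resonant delays, persistence of zeros, and deformation of the torus. -/

section Necessity

open Filter Topology
open scoped Matrix.Norms.Operator

/-- Zeros of a continuous family of entire functions persist under perturbation (Hurwitz). -/
lemma eventually_exists_zero_mem_closedBall {P : Type*} [TopologicalSpace P] {F : P → ℂ → ℂ}
    (hF : Continuous (Function.uncurry F)) (hd : ∀ p, Differentiable ℂ (F p)) {p₀ : P} {s₀ s₁ : ℂ}
    (h₀ : F p₀ s₀ = 0) (h₁ : F p₀ s₁ ≠ 0) {ε : ℝ} (hε : 0 < ε) :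
    ∀ᶠ p in 𝓝 p₀, ∃ s ∈ Metric.closedBall s₀ ε, F p s = 0 := by
  have han : AnalyticOnNhd ℂ (F p₀) Set.univ := fun s _ => (hd p₀).analyticAt s
  have hne : ∀ᶠ s in 𝓝[≠] s₀, F p₀ s ≠ 0 := by
    refine (han s₀ trivial).eventually_eq_zero_or_eventually_ne_zero.resolve_left fun h => h₁ ?_
    exact han.eqOn_zero_of_preconnected_of_eventuallyEq_zero isPreconnected_univ trivial h trivial
  rw [eventually_nhdsWithin_iff, Metric.eventually_nhds_iff] at hne
  obtain ⟨ρ, hρ, hne⟩ := hne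
  set r : ℝ := min ε (ρ / 2) with hr
  have hr0 : 0 < r := lt_min hε (half_pos hρ)
  have hrρ : r < ρ := (min_le_right _ _).trans_lt (half_lt_self hρ)
  have hsne : ∀ s ∈ Metric.sphere s₀ r, 0 < ‖F p₀ s‖ := fun s hs => by
    rw [Metric.mem_sphere] at hs
    refine norm_pos_iff.2 (hne (by rw [hs]; exact hrρ) fun h => ?_)
    rw [Set.mem_singleton_iff.1 h, dist_self] at hs
    exact hr0.ne hs
  have hcont : ∀ p, Continuous (F p) := fun p => (hd p).continuous
  obtain ⟨s₂, hs₂, hmin⟩ := (isCompact_sphere s₀ r).exists_isMinOn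
    (NormedSpace.sphere_nonempty.2 hr0.le) (hcont p₀).norm.continuousOn
  set c : ℝ := ‖F p₀ s₂‖ / 2 with hc
  have hc0 : 0 < c := half_pos (hsne s₂ hs₂)
  have hev1 : ∀ᶠ p in 𝓝 p₀, ∀ s ∈ Metric.sphere s₀ r, c < ‖F p s‖ := by
    refine (isCompact_sphere s₀ r).eventually_forall_of_forall_eventually fun s hs => ?_
    refine hF.norm.continuousAt.eventually_const_lt ?_
    exact (half_lt_self (hsne s₂ hs₂)).trans_le (hmin hs)
  have hev2 : ∀ᶠ p in 𝓝 p₀, ‖F p s₀‖ < c := by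
    have hcp : Continuous fun p => ‖F p s₀‖ := (hF.comp (Continuous.prodMk_left s₀)).norm
    exact hcp.continuousAt.eventually_lt_const (by simpa [h₀] using hc0)
  filter_upwards [hev1, hev2] with p hp1 hp2
  by_contra! hnz
  have hnz' : ∀ s ∈ closure (Metric.ball s₀ r), F p s ≠ 0 := fun s hs =>
    hnz s (Metric.closedBall_subset_closedBall (min_le_left _ _)
      (Metric.closure_ball_subset_closedBall hs))
  -- Without zeros, `1 / F p` is holomorphic on the ball; it is at most `1 / c` on the sphere but
  -- larger at the centre, against the maximum principle.
  have hle := Complex.norm_le_of_forall_mem_frontier_norm_le (U := Metric.ball s₀ r) (C := c⁻¹)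
    Metric.isBounded_ball ((hd p).diffContOnCl.inv hnz') (fun s hs => ?_)
    (subset_closure (Metric.mem_ball_self hr0))
  · rw [Pi.inv_apply, norm_inv] at hle
    have h3 := norm_pos_iff.2 (hnz' s₀ (subset_closure (Metric.mem_ball_self hr0)))
    exact (not_lt.2 ((inv_le_inv₀ h3 hc0).1 hle)) hp2
  · rw [frontier_ball s₀ hr0.ne'] at hs
    rw [Pi.inv_apply, norm_inv]
    exact inv_anti₀ hc0 (hp1 s hs).le

lemma norm_le_of_det_eq_zero {m n : ℕ} (H : Fin m → Matrix (Fin n) (Fin n) ℝ) (w : Fin m → ℂ)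
    {μ : ℂ} (h : (μ • (1 : Matrix (Fin n) (Fin n) ℂ) + symbolMatrix H w).det = 0) :
    ‖μ‖ ≤ ∑ k, ‖w k‖ * ‖H k‖ := by
  obtain ⟨v, hv0, hv⟩ := Matrix.exists_mulVec_eq_zero_iff.2 h
  rw [Matrix.add_mulVec, Matrix.smul_mulVec, Matrix.one_mulVec, add_eq_zero_iff_eq_neg] at hv
  have h1 : ‖μ‖ * ‖v‖ ≤ ‖symbolMatrix H w‖ * ‖v‖ := by
    rw [← norm_smul, hv, norm_neg]
    exact Matrix.linfty_opNorm_mulVec _ _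
  refine (le_of_mul_le_mul_right h1 (norm_pos_iff.2 hv0)).trans ?_
  refine (norm_sum_le _ _).trans (Finset.sum_le_sum fun k _ => ?_)
  rw [norm_smul]
  exact (congrArg (‖w k‖ * ·) (norm_mapMatrix_ofReal (H k))).le

lemma det_smul_one_add_symbolMatrix {m n : ℕ} (H : Fin m → Matrix (Fin n) (Fin n) ℝ)
    (w : Fin m → ℂ) {μ : ℂ} (hμ : μ ≠ 0) :
    (μ • (1 : Matrix (Fin n) (Fin n) ℂ) + symbolMatrix H w).det =
      μ ^ n * (1 + symbolMatrix H fun k => w k / μ).det := by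
  have : μ • (1 : Matrix (Fin n) (Fin n) ℂ) + symbolMatrix H w =
      μ • (1 + symbolMatrix H fun k => w k / μ) := by
    rw [smul_add, symbolMatrix, symbolMatrix, Finset.smul_sum]
    simp only [smul_smul, mul_div_cancel₀ _ hμ]
  rw [this, Matrix.det_smul, Fintype.card_fin]

lemma continuous_symbolMatrix_det {m n : ℕ} (H : Fin m → Matrix (Fin n) (Fin n) ℝ) :
    Continuous fun q : ℂ × (Fin m → ℂ) =>
      (q.1 • (1 : Matrix (Fin n) (Fin n) ℂ) + symbolMatrix H q.2).det := by
  have : Continuous fun q : ℂ × (Fin m → ℂ) =>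
      (Matrix.of fun i j => q.1 * (1 : Matrix (Fin n) (Fin n) ℂ) i j +
        ∑ k, q.2 k * (H k i j : ℂ) : Matrix (Fin n) (Fin n) ℂ) :=
    continuous_matrix fun i j => by simp only [Matrix.of_apply]; fun_prop
  convert! this.matrix_det using 3 with q
  ext i j
  simp [symbolMatrix, Matrix.sum_apply]

lemma differentiable_symbolMatrix_det {m n : ℕ} (H : Fin m → Matrix (Fin n) (Fin n) ℝ)
    {f : ℂ → ℂ} {w : ℂ → Fin m → ℂ} (hf : Differentiable ℂ f)
    (hw : ∀ k, Differentiable ℂ fun s => w s k) :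
    Differentiable ℂ fun s =>
      (f s • (1 : Matrix (Fin n) (Fin n) ℂ) + symbolMatrix H (w s)).det := by
  simp only [Matrix.det_apply, symbolMatrix, Matrix.add_apply, Matrix.smul_apply, Matrix.sum_apply,
    Matrix.map_apply, smul_eq_mul, zsmul_eq_mul, Units.smul_def]
  fun_prop

/-- An exponential solution with nonnegative growth rate contradicts exponential stability. -/
lemma det_ne_zero_of_exponentiallyStable {m n : ℕ} {H : Fin m → Matrix (Fin n) (Fin n) ℝ}
    {τ : Fin m → ℝ} (hst : ExponentiallyStable H τ) {s : ℂ} (hs : 0 ≤ s.re) :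
    (1 + symbolMatrix H fun k => Complex.exp (-s * τ k)).det ≠ 0 := by
  intro hdet
  obtain ⟨v, hv0, hv⟩ := Matrix.exists_mulVec_eq_zero_iff.2 hdet
  obtain ⟨M, α, hα, hM⟩ := hst
  have hsol : ∀ c : ℂ, IsSolution H τ fun t i => (c * Complex.exp (s * t) * v i).re := by
    intro c
    refine ⟨by fun_prop, fun t _ => ?_⟩
    ext i
    have h1 := congrFun hv i
    simp only [Matrix.add_mulVec, Matrix.one_mulVec, symbolMatrix, Matrix.sum_mulVec,
      Matrix.smul_mulVec, Pi.add_apply, Finset.sum_apply, Pi.smul_apply, Pi.zero_apply,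
      smul_eq_mul] at h1 ⊢
    simp only [Matrix.mulVec, dotProduct, Matrix.map_apply] at h1 ⊢
    have h2 := congrArg (fun y : ℂ => (c * Complex.exp (s * t) * y).re) h1
    simp only [mul_add, mul_zero, Complex.zero_re, Complex.add_re, Finset.mul_sum,
      Complex.re_sum] at h2
    rw [← h2]
    congr 1
    refine Finset.sum_congr rfl fun k _ => Finset.sum_congr rfl fun j _ => ?_
    rw [← Complex.re_ofReal_mul]
    congr 1
    have : Complex.exp (s * ((t - τ k : ℝ) : ℂ)) = Complex.exp (s * t) * Complex.exp (-s * τ k) := by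
      rw [← Complex.exp_add]; congr 1; push_cast; ring
    rw [this]
    ring
  have hbd : ∀ c : ℂ, ‖c‖ = 1 → ∀ t : ℝ, 0 ≤ t → ∀ i,
      |(c * Complex.exp (s * t) * v i).re| ≤ M * Real.exp (-α * t) * ‖v‖ := by
    intro c hc t ht i
    refine le_trans ?_ (hM _ (hsol c) ‖v‖ (fun r hr => ?_) t ht)
    · exact norm_le_pi_norm (fun i => (c * Complex.exp (s * t) * v i).re) i
    · refine (pi_norm_le_iff_of_nonneg (norm_nonneg _)).2 fun i => ?_
      refine (Complex.abs_re_le_norm _).trans ?_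
      rw [norm_mul, norm_mul, hc, one_mul, Complex.norm_exp]
      have h1 : Real.exp (s * r).re ≤ 1 := by
        rw [Real.exp_le_one_iff, Complex.re_mul_ofReal]
        exact mul_nonpos_of_nonneg_of_nonpos hs hr.2
      calc _ ≤ 1 * ‖v i‖ := by gcongr
        _ ≤ ‖v‖ := by rw [one_mul]; exact norm_le_pi_norm v i
  obtain ⟨i, hi⟩ := Function.ne_iff.1 hv0
  have hlow : ∀ t : ℝ, 0 ≤ t → ‖v i‖ ≤ 2 * (M * Real.exp (-α * t) * ‖v‖) := by
    intro t ht
    have h1 : ‖v i‖ ≤ ‖Complex.exp (s * t) * v i‖ := by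
      rw [norm_mul, Complex.norm_exp]
      refine le_mul_of_one_le_left (norm_nonneg _) (Real.one_le_exp ?_)
      rw [Complex.re_mul_ofReal]
      positivity
    have h2 := hbd 1 norm_one t ht i
    -- The multipliers `1` and `-i` give real solutions carrying the real and imaginary parts of the
    -- complex exponential.
    have h3 := hbd (-Complex.I) (by simp) t ht i
    have h4 : (-Complex.I * Complex.exp (s * t) * v i).re = (Complex.exp (s * t) * v i).im := by
      rw [mul_assoc]; simp
    rw [one_mul] at h2
    rw [h4] at h3
    linarith [Complex.norm_le_abs_re_add_abs_im (Complex.exp (s * t) * v i)]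
  have hlim : Tendsto (fun t : ℝ => 2 * (M * Real.exp (-α * t) * ‖v‖)) atTop (𝓝 0) := by
    have h1 : Tendsto (fun t : ℝ => Real.exp (-α * t)) atTop (𝓝 0) :=
      Real.tendsto_exp_atBot.comp (tendsto_id.const_mul_atTop_of_neg (by linarith))
    simpa using ((h1.const_mul M).mul_const ‖v‖).const_mul 2
  have := ge_of_tendsto hlim ((eventually_ge_atTop 0).mono hlow)
  exact hi (norm_le_zero_iff.1 this)

/-- Delays arbitrarily close to given ones resonate with prescribed phases. -/
lemma exists_resonant_delays {m : ℕ} (τ : Fin m → ℝ) (z : Fin m → ℂ) (hz : ∀ k, ‖z k‖ = 1)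
    {ε : ℝ} (hε : 0 < ε) :
    ∃ (τ' : Fin m → ℝ) (ω : ℝ), (∀ k, |τ' k - τ k| < ε) ∧
      ∀ k, Complex.exp (-(ω * Complex.I) * τ' k) = z k := by
  have hπ := Real.pi_pos
  -- Delays realising a given phase at frequency `ω` are spaced `2π / ω = ε / 2` apart.
  set ω : ℝ := 4 * Real.pi / ε with hω
  have hω0 : 0 < ω := by positivity
  set N : Fin m → ℤ := fun k => ⌊(ω * τ k + (z k).arg) / (2 * Real.pi)⌋ with hN
  refine ⟨fun k => (N k * (2 * Real.pi) - (z k).arg) / ω, ω, fun k => ?_, fun k => ?_⟩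
  · have h1 : (N k : ℝ) * (2 * Real.pi) ≤ ω * τ k + (z k).arg :=
      (le_div_iff₀ (by positivity)).1 (Int.floor_le _)
    have h2 : ω * τ k + (z k).arg < (N k + 1) * (2 * Real.pi) :=
      (div_lt_iff₀ (by positivity)).1 (Int.lt_floor_add_one _)
    have h3 : ω * ε = 4 * Real.pi := by rw [hω]; field_simp
    have h4 : (N k * (2 * Real.pi) - (z k).arg) / ω - τ k =
        (N k * (2 * Real.pi) - (z k).arg - ω * τ k) / ω := by field_simp
    rw [h4, abs_div, abs_of_pos hω0, div_lt_iff₀ hω0, abs_lt]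
    constructor <;> nlinarith
  · have hωc : (ω : ℂ) ≠ 0 := by exact_mod_cast hω0.ne'
    have h1 : -(ω * Complex.I) * (((N k * (2 * Real.pi) - (z k).arg) / ω : ℝ) : ℂ) =
        (z k).arg * Complex.I - N k * (2 * Real.pi * Complex.I) := by
      push_cast; field_simp; ring
    rw [h1, Complex.exp_periodic.sub_int_mul_eq]
    simpa [hz k] using Complex.norm_mul_exp_arg_mul_I (z k)

lemma exists_large_weight {m n : ℕ} (H : Fin m → Matrix (Fin n) (Fin n) ℝ) {τ : Fin m → ℝ}
    (hτ : ∀ k, 0 < τ k) :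
    ∃ a₁ : ℝ, ∀ a, a₁ ≤ a → ∑ k, Real.exp (-a * τ k) * ‖H k‖ < 1 := by
  have h1 : ∀ k, Tendsto (fun a : ℝ => Real.exp (-a * τ k) * ‖H k‖) atTop (𝓝 0) := by
    intro k
    have : Tendsto (fun a : ℝ => Real.exp (-a * τ k)) atTop (𝓝 0) :=
      Real.tendsto_exp_atBot.comp (tendsto_neg_atTop_atBot.atBot_mul_const (hτ k))
    simpa using this.mul_const ‖H k‖
  have h2 := tendsto_finsetSum Finset.univ fun k _ => h1 k
  rw [Finset.sum_const_zero] at h2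
  exact eventually_atTop.1 (h2.eventually_lt_const one_pos)

lemma norm_mul_cexp_neg {z : ℂ} (hz : ‖z‖ = 1) (a t : ℝ) :
    ‖z * Complex.exp (-(a : ℂ) * t)‖ = Real.exp (-a * t) := by
  rw [norm_mul, hz, one_mul, Complex.norm_exp]
  simp

/-- At resonant delays `F τ' s` is the characteristic determinant at `s + iω`, nonzero for `Re s ≥
0`. A zero of `F τ` at `a > 0` would persist there for nearby delays. -/
lemma weighted_det_ne_zero_of_locallyStronglyStable {m n : ℕ}
    {H : Fin m → Matrix (Fin n) (Fin n) ℝ} {τ : Fin m → ℝ} (hτ : ∀ k, 0 < τ k)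
    (hst : LocallyStronglyStable H τ) {z : Fin m → ℂ} (hz : ∀ k, ‖z k‖ = 1) {a : ℝ}
    (ha : 0 ≤ a) :
    (1 + symbolMatrix H fun k => z k * Complex.exp (-(a : ℂ) * τ k)).det ≠ 0 := by
  obtain ⟨δ, hδ, hst⟩ := hst
  obtain ⟨c, hc0, hc⟩ := exists_pos_le hτ
  set F : (Fin m → ℝ) → ℂ → ℂ := fun τ' s =>
    ((1 : ℂ) • (1 : Matrix (Fin n) (Fin n) ℂ) +
      symbolMatrix H fun k => z k * Complex.exp (-s * τ' k)).det with hFdef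
  have hnear : ∀ ε > 0, ∃ τ' : Fin m → ℝ, (∀ k, |τ' k - τ k| < ε) ∧
      ∀ s : ℂ, 0 ≤ s.re → F τ' s ≠ 0 := by
    intro ε hε
    obtain ⟨τ', ω, h1, h2⟩ := exists_resonant_delays τ z hz (lt_min hε (lt_min hδ hc0))
    refine ⟨τ', fun k => (h1 k).trans_le (min_le_left _ _), fun s hs => ?_⟩
    have h3 := det_ne_zero_of_exponentiallyStable (hst τ' (fun k => ?_) fun k =>
      (h1 k).trans_le ((min_le_right _ _).trans (min_le_left _ _)))
      (s := ω * Complex.I + s) (by simpa using hs)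
    · simp only [hFdef, one_smul]
      convert! h3 using 5 with k
      rw [← h2 k, ← Complex.exp_add]
      congr 1
      ring
    · have := (abs_lt.1 ((h1 k).trans_le ((min_le_right _ _).trans (min_le_right _ _)))).1
      linarith [hc k]
  have goal : F τ a ≠ 0 := by
    -- At `a = 0` the value does not depend on the delays, so no limit is needed; for `a > 0` the
    -- disc of radius `a` stays in the closed right half-plane.
    rcases ha.eq_or_lt with rfl | ha
    · obtain ⟨τ', -, h⟩ := hnear 1 one_pos
      simpa [hFdef] using h 0 le_rfl
    · intro h0
      obtain ⟨a₁, ha₁⟩ := exists_large_weight H hτ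
      have h1 : F τ (a₁ : ℂ) ≠ 0 := fun h1 => by
        have h2 := norm_le_of_det_eq_zero H _ h1
        simp only [norm_mul_cexp_neg (hz _), norm_one] at h2
        linarith [ha₁ a₁ le_rfl]
      have hcont : Continuous (Function.uncurry F) :=
        (continuous_symbolMatrix_det H).comp (f := fun q : (Fin m → ℝ) × ℂ =>
          ((1 : ℂ), fun k => z k * Complex.exp (-q.2 * q.1 k))) (by fun_prop)
      have hev := eventually_exists_zero_mem_closedBall hcont
        (fun τ' => differentiable_symbolMatrix_det H (by fun_prop) fun k => by fun_prop) h0 h1 ha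
      obtain ⟨ε, hε, hball⟩ := Metric.eventually_nhds_iff.1 hev
      obtain ⟨τ', h2, h3⟩ := hnear ε hε
      obtain ⟨s, hs, hs0⟩ := hball ((dist_pi_lt_iff hε).2 fun k => by
        rw [Real.dist_eq]; exact h2 k)
      refine h3 s ?_ hs0
      rw [mem_closedBall_iff_norm] at hs
      have := (abs_le.1 ((Complex.abs_re_le_norm _).trans hs)).1
      simp at this
      linarith
  simpa [hFdef] using goal

/-- Deforming the torus through weighted tori, no eigenvalue can leave the unit disc. -/
lemma norm_lt_one_of_weighted_det_ne_zero {m n : ℕ} {H : Fin m → Matrix (Fin n) (Fin n) ℝ}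
    {τ : Fin m → ℝ} (hτ : ∀ k, 0 < τ k)
    (h : ∀ z : Fin m → ℂ, (∀ k, ‖z k‖ = 1) → ∀ a : ℝ, 0 ≤ a →
      (1 + symbolMatrix H fun k => z k * Complex.exp (-(a : ℂ) * τ k)).det ≠ 0)
    (z : Fin m → ℂ) (hz : ∀ k, ‖z k‖ = 1) (μ : ℂ)
    (hμ : (μ • (1 : Matrix (Fin n) (Fin n) ℂ) + symbolMatrix H z).det = 0) : ‖μ‖ < 1 := by
  by_contra! hμ1
  set G : ℝ → (Fin m → ℂ) → ℂ → ℂ := fun a z μ => (μ • (1 : Matrix (Fin n) (Fin n) ℂ) +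
    symbolMatrix H fun k => z k * Complex.exp (-(a : ℂ) * τ k)).det with hG
  have hGc : Continuous fun q : ℝ × (Fin m → ℂ) × ℂ => G q.1 q.2.1 q.2.2 :=
    (continuous_symbolMatrix_det H).comp (f := fun q : ℝ × (Fin m → ℂ) × ℂ =>
      (q.2.2, fun k => q.2.1 k * Complex.exp (-(q.1 : ℂ) * τ k))) (by fun_prop)
  obtain ⟨a₁, ha₁⟩ := exists_large_weight H hτ
  have hbound : ∀ a z μ, (∀ k, ‖z k‖ = 1) → G a z μ = 0 →
      ‖μ‖ ≤ ∑ k, Real.exp (-a * τ k) * ‖H k‖ := by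
    intro a z μ hz h0
    have := norm_le_of_det_eq_zero H _ h0
    simpa only [norm_mul_cexp_neg (hz _)] using this
  set C : ℝ := ∑ k, ‖H k‖ with hC
  have hboundC : ∀ a z μ, 0 ≤ a → (∀ k, ‖z k‖ = 1) → G a z μ = 0 → ‖μ‖ ≤ C := by
    intro a z μ ha hz h0
    refine (hbound a z μ hz h0).trans (Finset.sum_le_sum fun k _ => ?_)
    refine mul_le_of_le_one_left (norm_nonneg _) (Real.exp_le_one_iff.2 ?_)
    have := mul_nonneg ha (hτ k).le
    linarith
  set K : Set (ℝ × (Fin m → ℂ) × ℂ) :=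
    (Set.Icc 0 a₁ ×ˢ ((Set.univ.pi fun _ => Metric.sphere 0 1) ×ˢ Metric.closedBall 0 C)) ∩
      {q | 1 ≤ ‖q.2.2‖ ∧ G q.1 q.2.1 q.2.2 = 0} with hK
  have hKmem : ∀ a z μ, 0 ≤ a → (∀ k, ‖z k‖ = 1) → 1 ≤ ‖μ‖ → G a z μ = 0 → (a, z, μ) ∈ K := by
    intro a z μ ha hz hμ h0
    refine ⟨⟨⟨ha, ?_⟩, fun k _ => by simpa using hz k, ?_⟩, hμ, h0⟩
    · by_contra! hlt
      linarith [hbound a z μ hz h0, ha₁ a hlt.le]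
    · simpa using hboundC a z μ ha hz h0
  have hKc : IsCompact K := by
    refine IsCompact.inter_right (isCompact_Icc.prod
      ((isCompact_univ_pi fun _ => isCompact_sphere _ _).prod (isCompact_closedBall _ _))) ?_
    exact (isClosed_le continuous_const continuous_snd.snd.norm).inter
      (isClosed_eq hGc continuous_const)
  have hK0 : K.Nonempty := ⟨(0, z, μ), hKmem 0 z μ le_rfl hz hμ1 (by simpa [hG] using hμ)⟩
  -- The extremal weight is taken over all phases at once, so that changing `z'` stays inside the
  -- competition.
  obtain ⟨⟨a, z', ν⟩, hmem, hmax⟩ := hKc.exists_isMaxOn hK0 continuous_fst.continuousOn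
  obtain ⟨⟨⟨ha0, -⟩, hz', -⟩, hν, hzero⟩ := id hmem
  have hz'1 : ∀ k, ‖z' k‖ = 1 := fun k => by simpa using hz' k trivial
  simp only at ha0 hν hzero
  rcases hν.eq_or_lt with hν1 | hν1
  · have hν0 : ν ≠ 0 := fun h0 => by simp [h0] at hν1
    simp only [hG] at hzero
    rw [det_smul_one_add_symbolMatrix H _ hν0, mul_eq_zero] at hzero
    refine h (fun k => z' k / ν) (fun k => by rw [norm_div, hz'1, ← hν1, div_one]) a ha0 ?_
    refine Eq.trans ?_ (hzero.resolve_left (pow_ne_zero _ hν0))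
    simp only [div_mul_eq_mul_div]
  -- `C + 1` lies beyond the eigenvalue bound, so the determinant is not identically zero; radius
  -- `‖ν‖ - 1` keeps the perturbed eigenvalue at modulus at least one.
  · have hne : G a z' ((C + 1 : ℝ) : ℂ) ≠ 0 := fun h0 => by
      have h1 := hboundC a z' _ ha0 hz'1 h0
      rw [Complex.norm_real, Real.norm_eq_abs] at h1
      linarith [le_abs_self (C + 1)]
    have hcont : Continuous (Function.uncurry fun a => G a z') :=
      hGc.comp (f := fun q : ℝ × ℂ => (q.1, z', q.2)) (by fun_prop)
    have hev := eventually_exists_zero_mem_closedBall hcont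
      (fun a' => differentiable_symbolMatrix_det H (by fun_prop) fun k => by fun_prop) hzero hne
      (sub_pos.2 hν1)
    obtain ⟨a', ⟨s, hs, hs0⟩, ha'⟩ := ((hev.filter_mono nhdsWithin_le_nhds).and
      (self_mem_nhdsWithin : Set.Ioi a ∈ 𝓝[>] a)).exists
    rw [mem_closedBall_iff_norm'] at hs
    have h1 := norm_sub_norm_le ν s
    have h2 : a' ≤ a := hmax (hKmem a' z' s (ha0.trans (Set.mem_Ioi.1 ha').le) hz'1 (by linarith) hs0)
    exact absurd (Set.mem_Ioi.1 ha') (not_lt.2 h2)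

end Necessity

end DelayDifference

theorem mainTheorem1 {m n : ℕ} (H : Fin m → Matrix (Fin n) (Fin n) ℝ) :
    (DelayDifference.StronglyStable H ↔
      ∀ z : Fin m → ℂ, (∀ k, ‖z k‖ = 1) → (DelayDifference.hermiteForm H z).PosDef) ∧
    (∀ τ : Fin m → ℝ, (∀ k, 0 < τ k) →
      (DelayDifference.LocallyStronglyStable H τ ↔
        ∀ z : Fin m → ℂ, (∀ k, ‖z k‖ = 1) → (DelayDifference.hermiteForm H z).PosDef)) := by
  have hsuff : (∀ z : Fin m → ℂ, (∀ k, ‖z k‖ = 1) →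
      (DelayDifference.hermiteForm H z).PosDef) → DelayDifference.StronglyStable H :=
    fun h τ hτ => DelayDifference.exponentiallyStable_of_det_ne_zero
      (fun z hz => (DelayDifference.hermiteForm_posDef_iff H z).1 (h z hz)) hτ
  have hnec : ∀ τ : Fin m → ℝ, (∀ k, 0 < τ k) → DelayDifference.LocallyStronglyStable H τ →
      ∀ z : Fin m → ℂ, (∀ k, ‖z k‖ = 1) → (DelayDifference.hermiteForm H z).PosDef :=
    fun τ hτ hst z hz => (DelayDifference.hermiteForm_posDef_iff H z).2
      (DelayDifference.norm_lt_one_of_weighted_det_ne_zero hτ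
        (fun z hz a ha =>
          DelayDifference.weighted_det_ne_zero_of_locallyStronglyStable hτ hst hz ha) z hz)
  have hloc : DelayDifference.StronglyStable H → ∀ τ : Fin m → ℝ,
      DelayDifference.LocallyStronglyStable H τ :=
    fun h τ => ⟨1, one_pos, fun τ' hτ' _ => h τ' hτ'⟩
  exact ⟨⟨fun h => hnec 1 (fun _ => one_pos) (hloc h 1), hsuff⟩,
    fun τ hτ => ⟨hnec τ hτ, fun h => hloc (hsuff h) τ⟩⟩
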